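/- **Lemma 4.1 (Energy lemma).** *Setting.* Let $\widehat{\mathbb M}^n$ ($n=2,3$) be the space of tensors of order $n$ over $\mathbb R^2$ whose components are invariant under permutations of the indices, with $A\cdot B=\sum A_{i_1\dots i_n}B_{i_1\dots i_n}$ and $|A|=(A\cdot A)^{1/2}$. For operator fields $\mathbb K,\mathbb L$ on $\widehat{\mathbb M}^n$, $\mathbb K\le\mathbb L$ a.e. in $\Omega$ means that $\mathbb K(x)A\cdot A\le\mathbb L(x)A\cdot A$ for all $A\in\widehat{\mathbb M}^n$ and a.e. $x\in\Omega$; $D^nu$ is the tensor of the weak derivatives of order $n$ of $u$. Let $t>0$, let $\Omega\subset\mathbb R^2$ be a bounded domain with boundary of class $C^{2,1}$ and outer unit normal $n$, and let $D\subseteq\Omega$ be measurable. Let $\mathbb P,\mathbb P^h,\widetilde{\mathbb P},\widetilde{\mathbb P}^h\in L^\infty(\Omega,\mathcal L(\widehat{\mathbb M}^2,\widehat{\mathbb M}^2))$ and $\mathbb Q,\widetilde{\mathbb Q}\in L^\infty(\Omega,\mathcal L(\widehat{\mathbb M}^3,\widehat{\mathbb M}^3))$ be symmetric, i.e. each of them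 satisfies $\mathbb K A\cdot B=\mathbb K B\cdot A$ a.e. in $\Omega$ for all symmetric tensors $A,B$. Let $0<\xi_0<\xi_1$ and $0<\overline\xi_0<\overline\xi_1$ be such that, for a.e. $x\in\Omega$ and all $A\in\widehat{\mathbb M}^2$, $B\in\widehat{\mathbb M}^3$, $$t^3\xi_0|A|^2\le(\mathbb P(x)+\mathbb P^h(x))A\cdot A\le t^3\xi_1|A|^2,\qquad t^5\overline\xi_0|B|^2\le\mathbb Q(x)B\cdot B\le t^5\overline\xi_1|B|^2 .$$ Let $\widehat V\in H^{-5/2}(\partial\Omega)$, $\widehat M_n\in H^{-3/2}(\partial\Omega)$, $\widehat M^h_n\in H^{-1/2}(\partial\Omega)$ (the duals of the spaces $H^{k-1/2}(\partial\Omega)$ of traces of $H^k(\Omega)$, $k=3,2,1$) satisfy the compatibility conditions $$\int_{\partial\Omega}\widehat V=0,\qquad\int_{\partial\Omega}\widehat Vx_\alpha+\widehat M_nn_\alpha=0\quad(\alpha=1,2),$$ where integrals over $\partial\Omega$ denote duality pairings, and put, for $w\in H^3(\Omega)$, $$L(w)=-\int_{\partial\Omega}\bigl(\widehat Vw+\widehat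 M_nw_{,n}+\widehat M_n^hw_{,nn}\bigr),\qquad w_{,n}=\sum_\alpha w_{,\alpha}n_\alpha,\quad w_{,nn}=\sum_{\alpha,\beta}w_{,\alpha\beta}n_\alpha n_\beta .$$ Let $u,u_0\in H^3(\Omega)$, both normalized by $\int_\Omega v=0$ and $\int_\Omega v_{,\alpha}=0$ ($\alpha=1,2$), be the weak solutions of the Neumann problem with and without the inclusion $D$: for every $w\in H^3(\Omega)$, $$\int_\Omega\bigl(\chi_{\Omega\setminus D}(\mathbb P+\mathbb P^h)+\chi_D(\widetilde{\mathbb P}+\widetilde{\mathbb P}^h)\bigr)D^2u\cdot D^2w+\bigl(\chi_{\Omega\setminus D}\mathbb Q+\chi_D\widetilde{\mathbb Q}\bigr)D^3u\cdot D^3w=L(w),$$ $$\int_\Omega(\mathbb P+\mathbb P^h)D^2u_0\cdot D^2w+\mathbb QD^3u_0\cdot D^3w=L(w).$$ Let $W=L(u)$, $W_0=L(u_0)$. Let $\eta,\overline\eta>0$ and $\delta,\overline\delta>0$, and set $\eta_*=\min\{\eta,\overline\eta\}$, $\delta^*=\max\{\delta,\overline\delta\}$, $\delta_*=\min\{\delta,\overline\delta\}$,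 $\xi_{0*}=\min\{\xi_0,\overline\xi_0\}$, $\xi_1^*=\max\{\xi_1,\overline\xi_1\}$. (i) If $\delta,\overline\delta>1$ and, a.e. in $\Omega$, $$\eta(\mathbb P+\mathbb P^h)\le(\widetilde{\mathbb P}+\widetilde{\mathbb P}^h)-(\mathbb P+\mathbb P^h)\le(\delta-1)(\mathbb P+\mathbb P^h),\qquad\overline\eta\,\mathbb Q\le\widetilde{\mathbb Q}-\mathbb Q\le(\overline\delta-1)\mathbb Q,$$ then $$\frac{\eta_*\xi_{0*}t^3}{\delta^*}\int_D|D^2u_0|^2+t^2|D^3u_0|^2\le W_0-W\le(\delta^*-1)\xi_1^*t^3\int_D|D^2u_0|^2+t^2|D^3u_0|^2 .$$ (ii) If $0<\delta,\overline\delta<1$ and, a.e. in $\Omega$, $$\eta(\mathbb P+\mathbb P^h)\le(\mathbb P+\mathbb P^h)-(\widetilde{\mathbb P}+\widetilde{\mathbb P}^h)\le(1-\delta)(\mathbb P+\mathbb P^h),\qquad\overline\eta\,\mathbb Q\le\mathbb Q-\widetilde{\mathbb Q}\le(1-\overline\delta)\mathbb Q,$$ then $$\eta_*\xi_{0*}t^3\int_D|D^2u_0|^2+t^2|D^3u_0|^2\le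 W-W_0\le\frac{(1-\delta_*)\xi_1^*t^3}{\delta_*}\int_D|D^2u_0|^2+t^2|D^3u_0|^2 .$$ -/

import Mathlib

open Real Set Filter Topology MeasureTheory
open scoped ENNReal ContDiff InnerProductSpace

noncomputable section

namespace Nanoplate

/-- The plane, with its Euclidean norm. -/
abbrev Plane : Type := EuclideanSpace ℝ (Fin 2)

/-! ### Tensors -/

/-- Tensors of order `n` over the plane, by their Cartesian components. The inner product is
`A · B = ∑ A_{i₁…iₙ} B_{i₁…iₙ}` and the norm is `|A| = (A · A)^{1/2}`. -/
abbrev Tensor (n : ℕ) : Type := EuclideanSpace ℝ (Fin n → Fin 2)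

/-- Tensors of order `n` whose components are invariant under permutations of the indices. -/
def SymTensor (n : ℕ) : Submodule ℝ (Tensor n) where
  carrier := {A | ∀ (p : Equiv.Perm (Fin n)) (i : Fin n → Fin 2), A (i ∘ p) = A i}
  add_mem' := fun ha hb p i => by simp [ha p i, hb p i]
  zero_mem' := fun p i => by simp
  smul_mem' := fun c A ha p i => by simp [ha p i]

/-- Fields of linear operators on symmetric tensors of order `n`. -/
abbrev TensorField (n : ℕ) : Type := Plane → (SymTensor n →L[ℝ] SymTensor n)

/-- `𝕂 ∈ L^∞(Ω, 𝓛(𝕄̂ⁿ, 𝕄̂ⁿ))`. -/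
def IsBoundedField {n : ℕ} (Ω : Set Plane) (K : TensorField n) : Prop :=
  MemLp K ∞ (volume.restrict Ω)

/-- `𝕂A · B = 𝕂B · A` for all symmetric `A, B`, almost everywhere in `Ω`. -/
def IsSymmField {n : ℕ} (Ω : Set Plane) (K : TensorField n) : Prop :=
  ∀ᵐ x ∂(volume.restrict Ω), ∀ A B : SymTensor n, ⟪K x A, B⟫_ℝ = ⟪K x B, A⟫_ℝ

/-- `𝕂 ≤ 𝕃` almost everywhere in `Ω`, in the sense of quadratic forms on symmetric tensors. -/
def FieldLE {n : ℕ} (Ω : Set Plane) (K L : TensorField n) : Prop :=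
  ∀ᵐ x ∂(volume.restrict Ω), ∀ A : SymTensor n, ⟪K x A, A⟫_ℝ ≤ ⟪L x A, A⟫_ℝ

/-- `c |A|² ≤ 𝕂A · A ≤ C |A|²` for all symmetric `A`, almost everywhere in `Ω`. -/
def FieldBounds {n : ℕ} (Ω : Set Plane) (K : TensorField n) (c C : ℝ) : Prop :=
  ∀ᵐ x ∂(volume.restrict Ω), ∀ A : SymTensor n,
    c * ‖A‖ ^ 2 ≤ ⟪K x A, A⟫_ℝ ∧ ⟪K x A, A⟫_ℝ ≤ C * ‖A‖ ^ 2

open Classical in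
/-- The field equal to `K'` in the inclusion `D` and to `K` outside `D`. -/
def withInclusion {n : ℕ} (D : Set Plane) (K K' : TensorField n) : TensorField n :=
  fun x => if x ∈ D then K' x else K x

/-! ### Sobolev spaces -/

/-- The tensor of classical partial derivatives of order `n`. -/
def classicalD (n : ℕ) (φ : Plane → ℝ) (x : Plane) : Tensor n :=
  WithLp.toLp 2 fun i => iteratedFDeriv ℝ n φ x fun l => EuclideanSpace.single (i l) 1

/-- `u ∈ L²(Ω)`, and `V ∈ L²(Ω)` is the (symmetric) tensor of all its weak derivatives of order
`n` in `Ω`. -/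
def IsWeakD (Ω : Set Plane) (n : ℕ) (u : Plane → ℝ) (V : Plane → SymTensor n) : Prop :=
  MemLp u 2 (volume.restrict Ω) ∧ MemLp V 2 (volume.restrict Ω) ∧
    ∀ φ : Plane → ℝ, ContDiff ℝ ∞ φ → HasCompactSupport φ → tsupport φ ⊆ Ω →
      ∀ i : Fin n → Fin 2,
        ∫ x in Ω, u x * classicalD n φ x i = (-1) ^ n * ∫ x in Ω, (V x : Tensor n) i * φ x

/-- `u ∈ H^k(Ω)`. -/
def MemH (Ω : Set Plane) (k : ℕ) (u : Plane → ℝ) : Prop :=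
  ∀ n ≤ k, ∃ V, IsWeakD Ω n u V

open Classical in
/-- `Dⁿu`, the tensor of weak derivatives of order `n` (unique up to null sets if it exists). -/
def weakD (Ω : Set Plane) (n : ℕ) (u : Plane → ℝ) : Plane → SymTensor n :=
  if h : ∃ V, IsWeakD Ω n u V then h.choose else 0

/-- The `H^k(Ω)` norm. -/
def sobolevNorm (Ω : Set Plane) (k : ℕ) (u : Plane → ℝ) : ℝ :=
  √(∑ n ∈ Finset.range (k + 1), ∫ x in Ω, ‖weakD Ω n u x‖ ^ 2)

/-! ### The boundary -/

/-- The open rectangle centred at the origin with sides `2a` and `2b`. -/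
def rect (a b : ℝ) : Set Plane := {x | |x 0| < a ∧ |x 1| < b}

/-- The `C^{k,α}([-r₀,r₀])` norm
`∑_{i ≤ k} r₀^i sup |g^{(i)}| + r₀^{k+α} sup_{s ≠ t} |g^{(k)}(t) - g^{(k)}(s)| / |t - s|^α`,
with value `∞` where a supremum is infinite. -/
def holderNorm (k : ℕ) (α r₀ : ℝ) (g : ℝ → ℝ) : ℝ≥0∞ :=
  let I : Set ℝ := Icc (-r₀) r₀
  let d : ℕ → ℝ → ℝ := fun i => iteratedDerivWithin i g I
  (∑ i ∈ Finset.range (k + 1), ENNReal.ofReal (r₀ ^ i) * ⨆ s ∈ I, ENNReal.ofReal |d i s|) +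
    ENNReal.ofReal (r₀ ^ ((k : ℝ) + α)) *
      ⨆ s ∈ I, ⨆ t ∈ I, ⨆ _ : t ≠ s, ENNReal.ofReal (|d k t - d k s| / |t - s| ^ α)

/-- The boundary of `Ω` is of class `C^{k,α}` with constants `r₀`, `M₀`: near each boundary point
`Ω` is, after a rigid motion, the region above the graph of a `C^{k,α}` function. -/
def BoundaryClassWith (Ω : Set Plane) (k : ℕ) (α r₀ M₀ : ℝ) : Prop :=
  ∀ P ∈ frontier Ω, ∃ (T : Plane ≃ᵃⁱ[ℝ] Plane) (g : ℝ → ℝ),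
    T P = 0 ∧
    (T '' Ω) ∩ rect r₀ (2 * M₀ * r₀) = {x | x ∈ rect r₀ (2 * M₀ * r₀) ∧ g (x 0) < x 1} ∧
    ContDiffOn ℝ k g (Icc (-r₀) r₀) ∧
    g 0 = 0 ∧ derivWithin g (Icc (-r₀) r₀) 0 = 0 ∧
    holderNorm k α r₀ g ≤ ENNReal.ofReal (M₀ * r₀)

/-- The boundary of `Ω` is of class `C^{k,α}`. -/
def BoundaryClass (Ω : Set Plane) (k : ℕ) (α : ℝ) : Prop :=
  ∃ r₀ M₀ : ℝ, 0 < r₀ ∧ 0 < M₀ ∧ BoundaryClassWith Ω k α r₀ M₀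

/-- The arclength measure on `∂Ω`. -/
def boundaryMeasure (Ω : Set Plane) : Measure Plane :=
  (μH[1] : Measure Plane).restrict (frontier Ω)

/-- `ν` is the unit outer normal to `∂Ω` at `x`: blown up at `x`, the set `Ω` becomes the
half-plane `{z | z · ν < 0}`. -/
def IsOuterNormal (Ω : Set Plane) (x ν : Plane) : Prop :=
  ‖ν‖ = 1 ∧ ∀ ε > 0, ∃ r > 0, ∀ y ∈ Metric.ball x r,
    (⟪y - x, ν⟫_ℝ < -ε * ‖y - x‖ → y ∈ Ω) ∧ (ε * ‖y - x‖ < ⟪y - x, ν⟫_ℝ → y ∉ Ω)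

open Classical in
/-- The unit outer normal to `∂Ω` (unique where it exists; it exists everywhere on a `C¹`
boundary). -/
def outerNormal (Ω : Set Plane) (x : Plane) : Plane :=
  if h : ∃ ν, IsOuterNormal Ω x ν then h.choose else 0

/-! ### Traces and Sobolev spaces on the boundary -/

/-- `g ∈ L²(∂Ω)` is the trace of `w ∈ H¹(Ω)`: there are smooth functions on the plane converging
to `w` in `H¹(Ω)` and to `g` in `L²(∂Ω)`. -/
def IsTrace (Ω : Set Plane) (w g : Plane → ℝ) : Prop :=
  MemLp g 2 (boundaryMeasure Ω) ∧ ∃ V : Plane → SymTensor 1, IsWeakD Ω 1 w V ∧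
    ∃ φ : ℕ → Plane → ℝ, (∀ m, ContDiff ℝ ∞ (φ m)) ∧
      Tendsto (fun m => eLpNorm (fun x => φ m x - w x) 2 (volume.restrict Ω)) atTop (𝓝 0) ∧
      Tendsto (fun m => eLpNorm (fun x => classicalD 1 (φ m) x - (V x : Tensor 1)) 2
        (volume.restrict Ω)) atTop (𝓝 0) ∧
      Tendsto (fun m => eLpNorm (fun x => φ m x - g x) 2 (boundaryMeasure Ω)) atTop (𝓝 0)

open Classical in
/-- The trace of `w` on `∂Ω` (for a bounded domain of class `C^{2,1}` every `w ∈ H¹(Ω)` has one,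
unique up to null sets of `∂Ω`). -/
def trace (Ω : Set Plane) (w : Plane → ℝ) : Plane → ℝ :=
  if h : ∃ g, IsTrace Ω w g then h.choose else 0

theorem classicalD_continuous (n : ℕ) {φ : Plane → ℝ} (hφ : ContDiff ℝ ∞ φ) :
    Continuous (classicalD n φ) := by
  have h : Continuous (iteratedFDeriv ℝ n φ) :=
    hφ.continuous_iteratedFDeriv (by exact_mod_cast le_top)
  unfold classicalD
  refine (PiLp.continuous_toLp 2 _).comp (continuous_pi fun i => ?_)
  exact (ContinuousMultilinearMap.apply ℝ (fun _ : Fin n => Plane) ℝ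
    (fun l => EuclideanSpace.single (i l) 1)).continuous.comp h

theorem classicalD_add (n : ℕ) {φ ψ : Plane → ℝ} (hφ : ContDiff ℝ ∞ φ) (hψ : ContDiff ℝ ∞ ψ)
    (x : Plane) : classicalD n (φ + ψ) x = classicalD n φ x + classicalD n ψ x := by
  have h1 : ContDiffAt ℝ n φ x := (hφ.of_le (by exact_mod_cast le_top)).contDiffAt
  have h2 : ContDiffAt ℝ n ψ x := (hψ.of_le (by exact_mod_cast le_top)).contDiffAt
  ext i
  simp [classicalD, iteratedFDeriv_add_apply h1 h2]

theorem classicalD_smul (n : ℕ) {φ : Plane → ℝ} (hφ : ContDiff ℝ ∞ φ) (c : ℝ)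
    (x : Plane) : classicalD n (c • φ) x = c • classicalD n φ x := by
  have h1 : ContDiffAt ℝ n φ x := (hφ.of_le (by exact_mod_cast le_top)).contDiffAt
  ext i
  simp [classicalD, iteratedFDeriv_const_smul_apply h1]

theorem memLp_of_testFunction {φ : Plane → ℝ} (hφ : Continuous φ) (hc : HasCompactSupport φ)
    (μ : Measure Plane) [IsFiniteMeasureOnCompacts μ] : MemLp φ 2 μ :=
  hφ.memLp_of_hasCompactSupport hc

theorem memLp_classicalD (n : ℕ) {φ : Plane → ℝ} (hφ : ContDiff ℝ ∞ φ) (hc : HasCompactSupport φ)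
    (i : Fin n → Fin 2) (μ : Measure Plane) [IsFiniteMeasureOnCompacts μ] :
    MemLp (fun x => classicalD n φ x i) 2 μ := by
  refine memLp_of_testFunction ?_ ?_ μ
  · exact (EuclideanSpace.proj (𝕜 := ℝ) i).continuous.comp (classicalD_continuous n hφ)
  · refine (hc.iteratedFDeriv (𝕜 := ℝ) n).mono' (fun x hx => subset_tsupport _ ?_)
    intro h0
    exact hx (by simp [classicalD, h0])

theorem memLp_component {n : ℕ} {V : Plane → SymTensor n} {μ : Measure Plane}
    (hV : MemLp V 2 μ) (i : Fin n → Fin 2) : MemLp (fun x => (V x : Tensor n) i) 2 μ :=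
  ((EuclideanSpace.proj (𝕜 := ℝ) i).comp (SymTensor n).subtypeL).comp_memLp' hV

theorem IsWeakD.add {Ω : Set Plane} {n : ℕ} {u u' : Plane → ℝ} {V V' : Plane → SymTensor n}
    (h : IsWeakD Ω n u V) (h' : IsWeakD Ω n u' V') : IsWeakD Ω n (u + u') (V + V') := by
  refine ⟨h.1.add h'.1, h.2.1.add h'.2.1, fun φ hφ hc hs i => ?_⟩
  have hd := memLp_classicalD n hφ hc i (volume.restrict Ω)
  have hp := memLp_of_testFunction hφ.continuous hc (volume.restrict Ω)
  have e1 := h.2.2 φ hφ hc hs i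
  have e2 := h'.2.2 φ hφ hc hs i
  simp only [Pi.add_apply, Submodule.coe_add, PiLp.add_apply, add_mul]
  have i1 : Integrable (fun x => u x * classicalD n φ x i) (volume.restrict Ω) :=
    h.1.integrable_mul hd
  have i2 : Integrable (fun x => u' x * classicalD n φ x i) (volume.restrict Ω) :=
    h'.1.integrable_mul hd
  have i3 : Integrable (fun x => (V x : Tensor n) i * φ x) (volume.restrict Ω) :=
    (memLp_component h.2.1 i).integrable_mul hp
  have i4 : Integrable (fun x => (V' x : Tensor n) i * φ x) (volume.restrict Ω) :=
    (memLp_component h'.2.1 i).integrable_mul hp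
  rw [integral_add i1 i2, integral_add i3 i4, e1, e2, mul_add]

theorem IsWeakD.smul {Ω : Set Plane} {n : ℕ} {u : Plane → ℝ} {V : Plane → SymTensor n}
    (h : IsWeakD Ω n u V) (c : ℝ) : IsWeakD Ω n (c • u) (c • V) := by
  refine ⟨h.1.const_smul c, h.2.1.const_smul c, fun φ hφ hc hs i => ?_⟩
  have e1 := h.2.2 φ hφ hc hs i
  simp only [Pi.smul_apply, Submodule.coe_smul, PiLp.smul_apply, smul_eq_mul, mul_assoc]
  rw [integral_const_mul, integral_const_mul, e1]
  ring

theorem isWeakD_zero (Ω : Set Plane) (n : ℕ) : IsWeakD Ω n 0 0 :=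
  ⟨MemLp.zero, MemLp.zero, fun φ _ _ _ i => by simp⟩

theorem IsTrace.add {Ω : Set Plane} {w w' g g' : Plane → ℝ} (h : IsTrace Ω w g)
    (h' : IsTrace Ω w' g') : IsTrace Ω (w + w') (g + g') := by
  obtain ⟨hg, V, hV, φ, hφ, a1, a2, a3⟩ := h
  obtain ⟨hg', V', hV', ψ, hψ, b1, b2, b3⟩ := h'
  refine ⟨hg.add hg', V + V', hV.add hV', fun m => φ m + ψ m, fun m => (hφ m).add (hψ m),
    ?_, ?_, ?_⟩
  · refine tendsto_of_tendsto_of_tendsto_of_le_of_le tendsto_const_nhds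
      (by simpa using a1.add b1) (fun _ => zero_le) fun m => ?_
    have := eLpNorm_add_le (p := 2) ((hφ m).continuous.aestronglyMeasurable.sub hV.1.1)
      ((hψ m).continuous.aestronglyMeasurable.sub hV'.1.1) (by norm_num)
    refine le_trans (le_of_eq ?_) this
    congr 1; ext x; simp; ring
  · refine tendsto_of_tendsto_of_tendsto_of_le_of_le tendsto_const_nhds
      (by simpa using a2.add b2) (fun _ => zero_le) fun m => ?_
    have k := (SymTensor 1).subtypeL.continuous.comp_aestronglyMeasurable hV.2.1.1
    have k' := (SymTensor 1).subtypeL.continuous.comp_aestronglyMeasurable hV'.2.1.1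
    have := eLpNorm_add_le (p := 2)
      ((classicalD_continuous 1 (hφ m)).aestronglyMeasurable.sub k)
      ((classicalD_continuous 1 (hψ m)).aestronglyMeasurable.sub k') (by norm_num)
    refine le_trans (le_of_eq ?_) this
    congr 1; ext1 x
    simp only [classicalD_add 1 (hφ m) (hψ m), Pi.add_apply, Pi.sub_apply, Submodule.coe_add,
      Submodule.subtypeL_apply]
    abel
  · refine tendsto_of_tendsto_of_tendsto_of_le_of_le tendsto_const_nhds
      (by simpa using a3.add b3) (fun _ => zero_le) fun m => ?_
    have := eLpNorm_add_le (p := 2) ((hφ m).continuous.aestronglyMeasurable.sub hg.1)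
      ((hψ m).continuous.aestronglyMeasurable.sub hg'.1) (by norm_num)
    refine le_trans (le_of_eq ?_) this
    congr 1; ext x; simp; ring

theorem IsTrace.smul {Ω : Set Plane} {w g : Plane → ℝ} (h : IsTrace Ω w g) (c : ℝ) :
    IsTrace Ω (c • w) (c • g) := by
  obtain ⟨hg, V, hV, φ, hφ, a1, a2, a3⟩ := h
  have key : ∀ {f : ℕ → ℝ≥0∞}, Tendsto f atTop (𝓝 0) →
      Tendsto (fun m => ‖c‖ₑ * f m) atTop (𝓝 0) := fun hf => by
    simpa using ENNReal.Tendsto.const_mul hf (Or.inr enorm_ne_top)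
  refine ⟨hg.const_smul c, c • V, hV.smul c, fun m => c • φ m, fun m => contDiff_const.smul (hφ m),
    ?_, ?_, ?_⟩
  · refine (key a1).congr fun m => ?_
    rw [← eLpNorm_const_smul]
    congr 1; ext x; simp; ring
  · refine (key a2).congr fun m => ?_
    rw [← eLpNorm_const_smul]
    congr 1; ext1 x
    simp only [classicalD_smul 1 (hφ m), Pi.smul_apply, Submodule.coe_smul, smul_sub]
  · refine (key a3).congr fun m => ?_
    rw [← eLpNorm_const_smul]
    congr 1; ext x; simp; ring

theorem isTrace_zero (Ω : Set Plane) : IsTrace Ω 0 0 := by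
  refine ⟨MemLp.zero, 0, isWeakD_zero Ω 1, fun _ => 0, fun _ => contDiff_const, ?_, ?_, ?_⟩
  · simp
  · have : classicalD 1 (0 : Plane → ℝ) = 0 := by
      ext x i
      simp [classicalD]
    simp [this]
  · simp

/-- The Sobolev space `H^{k-1/2}(∂Ω)`, as the space of traces on `∂Ω` of the functions in
`H^k(Ω)`. (Functions equal almost everywhere on `∂Ω` are not identified, but they have distance
zero for the norm below.) -/
def traceSpace (Ω : Set Plane) (k : ℕ) : Submodule ℝ (Plane → ℝ) where
  carrier := {g | ∃ w, MemH Ω k w ∧ IsTrace Ω w g}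
  add_mem' := by
    rintro g g' ⟨w, hw, hg⟩ ⟨w', hw', hg'⟩
    refine ⟨w + w', fun n hn => ?_, hg.add hg'⟩
    obtain ⟨V, hV⟩ := hw n hn
    obtain ⟨V', hV'⟩ := hw' n hn
    exact ⟨V + V', hV.add hV'⟩
  zero_mem' := ⟨0, fun n _ => ⟨0, isWeakD_zero Ω n⟩, isTrace_zero Ω⟩
  smul_mem' := by
    rintro c g ⟨w, hw, hg⟩
    refine ⟨c • w, fun n hn => ?_, hg.smul c⟩
    obtain ⟨V, hV⟩ := hw n hn
    exact ⟨c • V, hV.smul c⟩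

/-- The norm of `H^{k-1/2}(∂Ω)`: the infimum of the `H^k(Ω)` norms of all extensions. -/
def traceNorm (Ω : Set Plane) (k : ℕ) (g : Plane → ℝ) : ℝ :=
  sInf {r | ∃ w, MemH Ω k w ∧ IsTrace Ω w g ∧ r = sobolevNorm Ω k w}

/-- The space `H^{-(k-1/2)}(∂Ω)` of bounded linear functionals on `H^{k-1/2}(∂Ω)`. -/
def NegSobolev (Ω : Set Plane) (k : ℕ) : Submodule ℝ (Module.Dual ℝ (traceSpace Ω k)) where
  carrier := {V | ∃ C : ℝ, ∀ g : traceSpace Ω k, |V g| ≤ C * traceNorm Ω k g}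
  add_mem' := by
    rintro V V' ⟨C, hC⟩ ⟨C', hC'⟩
    refine ⟨C + C', fun g => (abs_add_le _ _).trans ?_⟩
    rw [add_mul]
    exact add_le_add (hC g) (hC' g)
  zero_mem' := ⟨0, fun g => by simp⟩
  smul_mem' := by
    rintro c V ⟨C, hC⟩
    refine ⟨|c| * C, fun g => ?_⟩
    rw [LinearMap.smul_apply, smul_eq_mul, abs_mul, mul_assoc]
    exact mul_le_mul_of_nonneg_left (hC g) (abs_nonneg c)

open Classical in
/-- The duality pairing `∫_{∂Ω} V g` of `V ∈ H^{-(k-1/2)}(∂Ω)` with `g ∈ H^{k-1/2}(∂Ω)`. -/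
def pairing {Ω : Set Plane} {k : ℕ} (V : NegSobolev Ω k) (g : Plane → ℝ) : ℝ :=
  if h : g ∈ traceSpace Ω k then V.1 ⟨g, h⟩ else 0

/-- The trace of the normal derivative, `w,ₙ = ∑ w,_α n_α`, on `∂Ω`. -/
def normalD (Ω : Set Plane) (w : Plane → ℝ) (x : Plane) : ℝ :=
  ∑ a : Fin 2, trace Ω (fun y => (weakD Ω 1 w y : Tensor 1) ![a]) x * outerNormal Ω x a

/-- The trace of the second normal derivative, `w,ₙₙ = ∑ w,_αβ n_α n_β`, on `∂Ω`. -/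
def normalD2 (Ω : Set Plane) (w : Plane → ℝ) (x : Plane) : ℝ :=
  ∑ a : Fin 2, ∑ b : Fin 2, trace Ω (fun y => (weakD Ω 2 w y : Tensor 2) ![a, b]) x *
    outerNormal Ω x a * outerNormal Ω x b

/-! ### The Neumann problem -/

/-- The Neumann data: shear force in `H^{-5/2}(∂Ω)`, bending moment in `H^{-3/2}(∂Ω)` and
high-order bending moment in `H^{-1/2}(∂Ω)`. -/
structure NeumannData (Ω : Set Plane) where
  V : NegSobolev Ω 3
  M : NegSobolev Ω 2
  Mh : NegSobolev Ω 1

/-- The compatibility conditions `∫ V = 0` and `∫ V x_α + M n_α = 0`, `α = 1, 2`. -/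
def NeumannData.Compatible {Ω : Set Plane} (F : NeumannData Ω) : Prop :=
  pairing F.V (fun _ => 1) = 0 ∧
    ∀ a : Fin 2, pairing F.V (fun x => x a) + pairing F.M (fun x => outerNormal Ω x a) = 0

/-- The work `L(w) = -∫_{∂Ω} V w + M w,ₙ + Mʰ w,ₙₙ` of the Neumann data on `w ∈ H³(Ω)`. -/
def NeumannData.work {Ω : Set Plane} (F : NeumannData Ω) (w : Plane → ℝ) : ℝ :=
  -(pairing F.V (trace Ω w) + pairing F.M (normalD Ω w) + pairing F.Mh (normalD2 Ω w))

/-- The bilinear form `a(u, w) = ∫_Ω 𝔸D²u · D²w + ℚD³u · D³w`. -/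
def energyForm (Ω : Set Plane) (A : TensorField 2) (Q : TensorField 3) (u w : Plane → ℝ) : ℝ :=
  ∫ x in Ω, (⟪A x (weakD Ω 2 u x), weakD Ω 2 w x⟫_ℝ + ⟪Q x (weakD Ω 3 u x), weakD Ω 3 w x⟫_ℝ)

/-- `u` is a weak solution in `H³(Ω)` of the Neumann problem with couple tensor `-𝔸D²u`,
high-order couple tensor `ℚD³u` and Neumann data `F`. -/
def IsWeakSolution (Ω : Set Plane) (A : TensorField 2) (Q : TensorField 3) (F : NeumannData Ω)
    (u : Plane → ℝ) : Prop :=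
  MemH Ω 3 u ∧ ∀ w, MemH Ω 3 w → energyForm Ω A Q u w = F.work w

/-- The normalization `∫_Ω u = 0`, `∫_Ω u,_α = 0`, `α = 1, 2`. -/
def Normalized (Ω : Set Plane) (u : Plane → ℝ) : Prop :=
  ∫ x in Ω, u x = 0 ∧ ∀ a : Fin 2, ∫ x in Ω, (weakD Ω 1 u x : Tensor 1) ![a] = 0

end Nanoplate

end

open Nanoplate

/-! The work of a weak solution can be computed by testing its own problem or the other one, because
the load is the same. If `q₀` and `q₁` are the energy forms without and with the inclusion, then
`q₀(u₀, u₀) = q₁(u, u₀) = W₀` and `q₁(u, u) = q₀(u₀, u) = W`. Hence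
`W₀ - W` is the integral of `q₀(u₀, u₀) - 2 q₀(u₀, u) + q₁(u, u)`, and `W - W₀` is the integral of
`q₁(u, u) - 2 q₁(u, u₀) + q₀(u₀, u₀)`; both integrands are values of `energyGap`.

All four inequalities are then pointwise, since one argument of the gap can be minimized out.
Completing the square around the solution scaled by `1 / m` bounds the gap below by `1 - 1 / m` times
the form of the first operator, as soon as the second operator is at least `m` times the first
(`energyGap_ge_of_smul_le`): `m = 1 + η` gives the lower bound for a stiff inclusion and `m = min δ δb`
the upper bound for a soft one. The other two bounds follow from
`energyGap_ge_sub`: the gap exceeds the difference of the two forms by a nonnegative square. Outside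
the inclusion the operators agree and the gap is nonnegative. -/

open Nanoplate

/-- The pointwise energy gap `𝕂Y·Y - 2 𝕂Y·X + 𝕃X·X`. If `Y` and `X` are the strains of the
solutions with tensors `𝕂` and `𝕃` under the same load, its integral is the work on the solution
for `𝕂` minus the work on the solution for `𝕃`. -/
def energyGap {E : Type*} [NormedAddCommGroup E] [InnerProductSpace ℝ E] (K L : E →L[ℝ] E)
    (X Y : E) : ℝ :=
  ⟪K Y, Y⟫_ℝ - 2 * ⟪K Y, X⟫_ℝ + ⟪L X, X⟫_ℝ

/-! ### Pointwise bounds on the energy gap -/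

section Pointwise

variable {E : Type*} [NormedAddCommGroup E] [InnerProductSpace ℝ E] {K L : E →L[ℝ] E}

theorem inner_clm_add_apply (K L : E →L[ℝ] E) (A B : E) :
    ⟪(K + L) A, B⟫_ℝ = ⟪K A, B⟫_ℝ + ⟪L A, B⟫_ℝ := by
  rw [_root_.add_apply, inner_add_left]

theorem inner_clm_sub_apply (K L : E →L[ℝ] E) (A B : E) :
    ⟪(K - L) A, B⟫_ℝ = ⟪K A, B⟫_ℝ - ⟪L A, B⟫_ℝ := by
  rw [_root_.sub_apply, inner_sub_left]

theorem inner_clm_smul_apply (c : ℝ) (K : E →L[ℝ] E) (A B : E) :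
    ⟪(c • K) A, B⟫_ℝ = c * ⟪K A, B⟫_ℝ := by
  rw [_root_.smul_apply, real_inner_smul_left]

/-- If `m 𝕂 ≤ 𝕃`, the gap dominates `𝕂Y·Y - 2 𝕂Y·X + m 𝕂X·X`, whose minimum over `X` is attained
at `X = Y / m`. -/
theorem energyGap_ge_of_smul_le (hK : ∀ A B : E, ⟪K A, B⟫_ℝ = ⟪K B, A⟫_ℝ)
    (hK0 : ∀ A : E, 0 ≤ ⟪K A, A⟫_ℝ) {m : ℝ} (hm : 0 < m)
    (h : ∀ A : E, m * ⟪K A, A⟫_ℝ ≤ ⟪L A, A⟫_ℝ) (X Y : E) :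
    (1 - 1 / m) * ⟪K Y, Y⟫_ℝ ≤ energyGap K L X Y := by
  have h1 := hK0 (m • X - Y)
  have h2 := h X
  have h3 := hK X Y
  simp only [map_sub, map_smul, inner_sub_left, inner_sub_right, real_inner_smul_left,
    real_inner_smul_right] at h1
  rw [h3] at h1
  have h4 : 0 ≤ (m * (m * ⟪K X, X⟫_ℝ) - m * ⟪K Y, X⟫_ℝ - (m * ⟪K Y, X⟫_ℝ - ⟪K Y, Y⟫_ℝ)) / m :=
    div_nonneg (by linarith) hm.le
  have h5 : (m * (m * ⟪K X, X⟫_ℝ) - m * ⟪K Y, X⟫_ℝ - (m * ⟪K Y, X⟫_ℝ - ⟪K Y, Y⟫_ℝ)) / m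
      = m * ⟪K X, X⟫_ℝ - 2 * ⟪K Y, X⟫_ℝ + 1 / m * ⟪K Y, Y⟫_ℝ := by
    field_simp
    ring
  unfold energyGap
  linarith

/-- The gap is `𝕂(X - Y)·(X - Y) + (𝕃 - 𝕂)X·X`, and the first term is nonnegative. -/
theorem energyGap_ge_sub (hK : ∀ A B : E, ⟪K A, B⟫_ℝ = ⟪K B, A⟫_ℝ)
    (hK0 : ∀ A : E, 0 ≤ ⟪K A, A⟫_ℝ) (X Y : E) :
    ⟪L X, X⟫_ℝ - ⟪K X, X⟫_ℝ ≤ energyGap K L X Y := by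
  have h1 := hK0 (X - Y)
  simp only [map_sub, inner_sub_left, inner_sub_right] at h1
  rw [hK X Y] at h1
  unfold energyGap
  linarith

end Pointwise

/-! ### Integration of the energy gap -/

section Integration

variable {n : ℕ} {Ω D : Set Plane}

/-- A bounded operator field maps square-integrable fields to square-integrable fields, so its
bilinear form is integrable on them. -/
theorem integrable_inner_clm_apply {α E : Type*} [MeasurableSpace α] {μ : Measure α}
    [NormedAddCommGroup E] [InnerProductSpace ℝ E] {K : α → E →L[ℝ] E} {V W : α → E}
    (hK : MemLp K ⊤ μ) (hV : MemLp V 2 μ) (hW : MemLp W 2 μ) :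
    Integrable (fun x => ⟪K x (V x), W x⟫_ℝ) μ := by
  have m : AEStronglyMeasurable (fun x => K x (V x)) μ :=
    (isBoundedBilinearMap_apply (𝕜 := ℝ) (E := E) (F := E)).continuous.comp_aestronglyMeasurable
      (hK.1.prodMk hV.1)
  have hb : ∀ᵐ x ∂μ, ‖K x (V x)‖ ≤ (eLpNorm K ⊤ μ).toReal * ‖V x‖ := by
    filter_upwards [ae_le_eLpNormEssSup (f := K) (μ := μ)] with x hx
    refine ((K x).le_opNorm _).trans (mul_le_mul_of_nonneg_right ?_ (norm_nonneg _))
    rw [← eLpNorm_exponent_top] at hx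
    simpa using ENNReal.toReal_mono hK.2.ne hx
  have hKV : MemLp (fun x => K x (V x)) 2 μ := hV.of_le_mul m hb
  refine (hKV.norm.integrable_mul hW.norm).mono' (m.inner hW.1) (.of_forall fun x => ?_)
  exact norm_inner_le_norm _ _

theorem memLp_top_add {α F : Type*} [MeasurableSpace α] {μ : Measure α} [NormedAddCommGroup F]
    {f g : α → F} (hf : MemLp f ⊤ μ) (hg : MemLp g ⊤ μ) : MemLp (f + g) ⊤ μ :=
  hf.add hg

open Classical in
theorem memLp_top_ite {α F : Type*} [MeasurableSpace α] {μ : Measure α} [NormedAddCommGroup F]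
    {f g : α → F} {D : Set α} (hf : MemLp f ⊤ μ) (hg : MemLp g ⊤ μ) (hD : NullMeasurableSet D μ) :
    MemLp (fun x => if x ∈ D then g x else f x) ⊤ μ := by
  have e : (fun x => if x ∈ D then g x else f x) = f + D.indicator (g - f) := by
    funext x
    by_cases hx : x ∈ D <;> simp [hx]
  have h : MemLp (g - f) ⊤ μ := MemLp.sub hg hf
  rw [e]
  refine MemLp.add hf (h.mono (h.1.indicator₀ hD) (.of_forall fun x => ?_))
  exact norm_indicator_le_norm_self _ x

-- The next two lemmas specialize the previous ones to operators on an abstract space. Unification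
-- of the norm and operator topologies is cheap there, and expensive for `SymTensor n`.
theorem memLp_top_clm_add {α E : Type*} [MeasurableSpace α] {μ : Measure α}
    [NormedAddCommGroup E] [NormedSpace ℝ E] {K K' : α → E →L[ℝ] E}
    (hK : MemLp K ⊤ μ) (hK' : MemLp K' ⊤ μ) : MemLp (K + K') ⊤ μ :=
  memLp_top_add hK hK'

open Classical in
theorem memLp_top_clm_ite {α E : Type*} [MeasurableSpace α] {μ : Measure α}
    [NormedAddCommGroup E] [NormedSpace ℝ E] {K K' : α → E →L[ℝ] E} {D : Set α}
    (hK : MemLp K ⊤ μ) (hK' : MemLp K' ⊤ μ) (hD : NullMeasurableSet D μ) :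
    MemLp (fun x => if x ∈ D then K' x else K x) ⊤ μ :=
  memLp_top_ite hK hK' hD

theorem Nanoplate.IsBoundedField.add {K K' : TensorField n} (hK : IsBoundedField Ω K)
    (hK' : IsBoundedField Ω K') : IsBoundedField Ω (K + K') :=
  memLp_top_clm_add (E := SymTensor n) hK hK'

theorem Nanoplate.IsBoundedField.withInclusion {K K' : TensorField n} (hK : IsBoundedField Ω K)
    (hK' : IsBoundedField Ω K') (hD : NullMeasurableSet D volume) :
    IsBoundedField Ω (withInclusion D K K') :=
  memLp_top_clm_ite (E := SymTensor n) hK hK'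
    (hD.mono_ac Measure.restrict_le_self.absolutelyContinuous)

theorem Nanoplate.IsBoundedField.integrable_inner {K : TensorField n} {V W : Plane → SymTensor n}
    (hK : IsBoundedField Ω K) (hV : MemLp V 2 (volume.restrict Ω))
    (hW : MemLp W 2 (volume.restrict Ω)) :
    Integrable (fun x => ⟪K x (V x), W x⟫_ℝ) (volume.restrict Ω) :=
  integrable_inner_clm_apply hK hV hW

theorem integrable_energyForm {A : TensorField 2} {Q : TensorField 3}
    {V₂ W₂ : Plane → SymTensor 2} {V₃ W₃ : Plane → SymTensor 3} (hA : IsBoundedField Ω A)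
    (hQ : IsBoundedField Ω Q) (hV₂ : MemLp V₂ 2 (volume.restrict Ω))
    (hW₂ : MemLp W₂ 2 (volume.restrict Ω)) (hV₃ : MemLp V₃ 2 (volume.restrict Ω))
    (hW₃ : MemLp W₃ 2 (volume.restrict Ω)) :
    Integrable (fun x => ⟪A x (V₂ x), W₂ x⟫_ℝ + ⟪Q x (V₃ x), W₃ x⟫_ℝ) (volume.restrict Ω) :=
  (hA.integrable_inner hV₂ hW₂).add (hQ.integrable_inner hV₃ hW₃)

theorem integrable_energyGap {K L : TensorField n} {V W : Plane → SymTensor n}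
    (hK : IsBoundedField Ω K) (hL : IsBoundedField Ω L) (hV : MemLp V 2 (volume.restrict Ω))
    (hW : MemLp W 2 (volume.restrict Ω)) :
    Integrable (fun x => energyGap (K x) (L x) (V x) (W x)) (volume.restrict Ω) :=
  ((hK.integrable_inner hW hW).sub ((hK.integrable_inner hW hV).const_mul 2)).add
    (hL.integrable_inner hV hV)

theorem memLp_weakD {k : ℕ} {u : Plane → ℝ} (hu : MemH Ω k u) (hn : n ≤ k) :
    MemLp (weakD Ω n u) 2 (volume.restrict Ω) := by
  have h := hu n hn
  rw [weakD, dif_pos h]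
  exact h.choose_spec.2.1

/-- Testing the problem for `v` with both solutions, and the problem for `u` with `u`, turns the
integral of the gap into a difference of works. -/
theorem integral_energyGap {A A' : TensorField 2} {Q Q' : TensorField 3} {F : NeumannData Ω}
    {u v : Plane → ℝ} (hA : IsBoundedField Ω A) (hA' : IsBoundedField Ω A')
    (hQ : IsBoundedField Ω Q) (hQ' : IsBoundedField Ω Q')
    (hv : IsWeakSolution Ω A Q F v) (hu : IsWeakSolution Ω A' Q' F u) :
    ∫ x in Ω, (energyGap (A x) (A' x) (weakD Ω 2 u x) (weakD Ω 2 v x) +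
      energyGap (Q x) (Q' x) (weakD Ω 3 u x) (weakD Ω 3 v x)) = F.work v - F.work u := by
  have hu2 := memLp_weakD (n := 2) hu.1 (by norm_num)
  have hu3 := memLp_weakD (n := 3) hu.1 le_rfl
  have hv2 := memLp_weakD (n := 2) hv.1 (by norm_num)
  have hv3 := memLp_weakD (n := 3) hv.1 le_rfl
  have i1 := integrable_energyForm hA hQ hv2 hv2 hv3 hv3
  have i2 := (integrable_energyForm hA hQ hv2 hu2 hv3 hu3).const_mul 2
  have i12 := i1.sub i2
  rw [Pi.sub_def] at i12
  have i3 := integrable_energyForm hA' hQ' hu2 hu2 hu3 hu3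
  have e1 := hv.2 v hv.1
  have e2 := hv.2 u hu.1
  have e3 := hu.2 u hu.1
  calc _ = energyForm Ω A Q v v - 2 * energyForm Ω A Q v u + energyForm Ω A' Q' u u := by
        unfold energyForm
        rw [← integral_const_mul, ← integral_sub i1 i2, ← integral_add i12 i3]
        refine integral_congr_ae (.of_forall fun x => ?_)
        simp only [energyGap]
        ring
    _ = _ := by rw [e1, e2, e3]; ring

theorem const_mul_setIntegral_le {c : ℝ} {f g : Plane → ℝ} (hD_sub : D ⊆ Ω)
    (hD : NullMeasurableSet D volume) (hf : Integrable f (volume.restrict Ω))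
    (hg : Integrable g (volume.restrict Ω))
    (h : ∀ᵐ x ∂(volume.restrict Ω), (x ∈ D → c * f x ≤ g x) ∧ (x ∉ D → 0 ≤ g x)) :
    c * ∫ x in D, f x ≤ ∫ x in Ω, g x := by
  have hD' : NullMeasurableSet D (volume.restrict Ω) :=
    hD.mono_ac Measure.restrict_le_self.absolutelyContinuous
  have hr : (volume.restrict Ω).restrict D = volume.restrict D := by
    rw [Measure.restrict_restrict₀ hD', Set.inter_eq_left.2 hD_sub]
  rw [← integral_const_mul, ← hr, ← integral_indicator₀ hD']
  refine integral_mono_ae ((hf.const_mul c).indicator₀ hD') hg ?_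
  filter_upwards [h] with x hx
  by_cases hxD : x ∈ D
  · simpa [hxD] using hx.1 hxD
  · simpa [hxD] using hx.2 hxD

/-- Pointwise bounds on the gaps of orders two and three integrate to a bound on the difference of
works. -/
theorem const_mul_setIntegral_le_work_sub {A A' : TensorField 2} {Q Q' : TensorField 3}
    {F : NeumannData Ω} {u v w : Plane → ℝ} (hA : IsBoundedField Ω A) (hA' : IsBoundedField Ω A')
    (hQ : IsBoundedField Ω Q) (hQ' : IsBoundedField Ω Q')
    (hv : IsWeakSolution Ω A Q F v) (hu : IsWeakSolution Ω A' Q' F u) (hw : MemH Ω 3 w)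
    (hD_sub : D ⊆ Ω) (hD : NullMeasurableSet D volume) {c c₃ t : ℝ} (hc₃ : c₃ = c * t ^ 2)
    (h2 : ∀ᵐ x ∂(volume.restrict Ω),
      (x ∈ D → c * ‖weakD Ω 2 w x‖ ^ 2 ≤
        energyGap (A x) (A' x) (weakD Ω 2 u x) (weakD Ω 2 v x)) ∧
      (x ∉ D → 0 ≤ energyGap (A x) (A' x) (weakD Ω 2 u x) (weakD Ω 2 v x)))
    (h3 : ∀ᵐ x ∂(volume.restrict Ω),
      (x ∈ D → c₃ * ‖weakD Ω 3 w x‖ ^ 2 ≤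
        energyGap (Q x) (Q' x) (weakD Ω 3 u x) (weakD Ω 3 v x)) ∧
      (x ∉ D → 0 ≤ energyGap (Q x) (Q' x) (weakD Ω 3 u x) (weakD Ω 3 v x))) :
    c * ∫ x in D, (‖weakD Ω 2 w x‖ ^ 2 + t ^ 2 * ‖weakD Ω 3 w x‖ ^ 2) ≤
      F.work v - F.work u := by
  have hu2 := memLp_weakD (n := 2) hu.1 (by norm_num)
  have hu3 := memLp_weakD (n := 3) hu.1 le_rfl
  have hv2 := memLp_weakD (n := 2) hv.1 (by norm_num)
  have hv3 := memLp_weakD (n := 3) hv.1 le_rfl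
  have hw2 := memLp_weakD (n := 2) hw (by norm_num)
  have hw3 := memLp_weakD (n := 3) hw le_rfl
  have hE : Integrable (fun x => ‖weakD Ω 2 w x‖ ^ 2 + t ^ 2 * ‖weakD Ω 3 w x‖ ^ 2)
      (volume.restrict Ω) :=
    ((memLp_two_iff_integrable_sq_norm hw2.1).1 hw2).add
      (((memLp_two_iff_integrable_sq_norm hw3.1).1 hw3).const_mul (t ^ 2))
  rw [← integral_energyGap hA hA' hQ hQ' hv hu]
  refine const_mul_setIntegral_le hD_sub hD hE
    ((integrable_energyGap hA hA' hu2 hv2).add (integrable_energyGap hQ hQ' hu3 hv3)) ?_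
  filter_upwards [h2, h3] with x k2 k3
  refine ⟨fun hx => ?_, fun hx => add_nonneg (k2.2 hx) (k3.2 hx)⟩
  refine le_trans (le_of_eq ?_) (add_le_add (k2.1 hx) (k3.1 hx))
  rw [hc₃]
  ring

end Integration

/-! ### The gap for fields that differ on an inclusion -/

section Inclusion

variable {n : ℕ} {Ω : Set Plane} {K K' : TensorField n} {s c₀ c₁ c δ η d e : ℝ}

theorem Nanoplate.IsSymmField.add (hK : IsSymmField Ω K) (hK' : IsSymmField Ω K') :
    IsSymmField Ω (K + K') := by
  filter_upwards [hK, hK'] with x h h' A B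
  rw [Pi.add_apply, inner_clm_add_apply, inner_clm_add_apply, h A B, h' A B]

theorem Nanoplate.FieldLE.smul_le_sub {K₁ K₂ : TensorField n} (h : FieldLE Ω (η • K) (K₁ - K₂)) :
    ∀ᵐ x ∂(volume.restrict Ω), ∀ A, η * ⟪K x A, A⟫_ℝ ≤ ⟪K₁ x A, A⟫_ℝ - ⟪K₂ x A, A⟫_ℝ := by
  filter_upwards [h] with x hx A
  rw [← inner_clm_smul_apply, ← inner_clm_sub_apply]
  exact hx A

theorem Nanoplate.FieldLE.sub_le_smul {K₁ K₂ : TensorField n} (h : FieldLE Ω (K₁ - K₂) (η • K)) :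
    ∀ᵐ x ∂(volume.restrict Ω), ∀ A, ⟪K₁ x A, A⟫_ℝ - ⟪K₂ x A, A⟫_ℝ ≤ η * ⟪K x A, A⟫_ℝ := by
  filter_upwards [h] with x hx A
  rw [← inner_clm_smul_apply, ← inner_clm_sub_apply]
  exact hx A

/-- Lower bound on the gap for a stiff inclusion. The upper bound on `K' - K` enters only through
its consequence `1 + η ≤ δ`. -/
theorem le_energyGap_withInclusion_of_stiffer (D : Set Plane) (hK : IsSymmField Ω K)
    (hb : FieldBounds Ω K (s * c₀) (s * c₁)) (hs : 0 < s) (hc : 0 < c) (hc₀ : c ≤ c₀)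
    (he : 0 < e) (heη : e ≤ η) (hd : δ ≤ d) (h₁ : FieldLE Ω (η • K) (K' - K))
    (h₂ : FieldLE Ω (K' - K) ((δ - 1) • K)) (X Y : Plane → SymTensor n) :
    ∀ᵐ x ∂(volume.restrict Ω),
      (x ∈ D → e * c * s / d * ‖Y x‖ ^ 2 ≤
        energyGap (K x) (withInclusion D K K' x) (X x) (Y x)) ∧
      (x ∉ D → 0 ≤ energyGap (K x) (withInclusion D K K' x) (X x) (Y x)) := by
  filter_upwards [hK, hb, h₁.smul_le_sub, h₂.sub_le_smul] with x sK bK k₁ k₂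
  have hc₀' : 0 < c₀ := hc.trans_le hc₀
  have hη : 0 < η := he.trans_le heη
  have hK0 : ∀ A, 0 ≤ ⟪K x A, A⟫_ℝ := fun A =>
    (by positivity : 0 ≤ s * c₀ * ‖A‖ ^ 2).trans (bK A).1
  refine ⟨fun hx => ?_, fun hx => ?_⟩
  · simp only [withInclusion, if_pos hx]
    have hgap := energyGap_ge_of_smul_le (L := K' x) sK hK0 (by linarith : 0 < 1 + η)
      (fun A => by linarith [k₁ A]) (X x) (Y x)
    -- `η ≤ δ - 1` is read off at `Y x`, which has to be nonzero.
    rcases eq_or_ne (Y x) 0 with h0 | h0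
    · simpa [h0] using hgap
    have hpos : 0 < ‖Y x‖ := norm_pos_iff.2 h0
    have hq : 0 < ⟪K x (Y x), Y x⟫_ℝ :=
      (by positivity : 0 < s * c₀ * ‖Y x‖ ^ 2).trans_le (bK _).1
    have hηδ : η ≤ δ - 1 := le_of_mul_le_mul_right ((k₁ _).trans (k₂ _)) hq
    have hratio : e / d ≤ 1 - 1 / (1 + η) := by
      have e1 : 1 - 1 / (1 + η) = η / (1 + η) := by field_simp; ring
      rw [e1]
      exact div_le_div₀ hη.le heη (by linarith) (by linarith)
    have hd0 : 0 < d := by linarith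
    calc e * c * s / d * ‖Y x‖ ^ 2 = e / d * (s * c * ‖Y x‖ ^ 2) := by ring
      _ ≤ (1 - 1 / (1 + η)) * ⟪K x (Y x), Y x⟫_ℝ := by
          refine mul_le_mul hratio ?_ (by positivity) ((by positivity : 0 ≤ e / d).trans hratio)
          exact le_trans (by gcongr) (bK _).1
      _ ≤ _ := hgap
  · simp only [withInclusion, if_neg hx]
    simpa using energyGap_ge_sub (L := K x) sK hK0 (X x) (Y x)

/-- Upper bound on the negative of the reversed gap, for a stiff inclusion. -/
theorem neg_le_energyGap_withInclusion_of_stiffer (D : Set Plane) (hK : IsSymmField Ω K)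
    (hK' : IsSymmField Ω K') (hb : FieldBounds Ω K (s * c₀) (s * c₁)) (hs : 0 < s)
    (hc₀ : 0 < c₀) (hc : c₁ ≤ c) (hη : 0 < η) (hδ : 1 < δ) (hd : δ ≤ d)
    (h₁ : FieldLE Ω (η • K) (K' - K)) (h₂ : FieldLE Ω (K' - K) ((δ - 1) • K))
    (X Y : Plane → SymTensor n) :
    ∀ᵐ x ∂(volume.restrict Ω),
      (x ∈ D → -((d - 1) * c * s) * ‖X x‖ ^ 2 ≤
        energyGap (withInclusion D K K' x) (K x) (X x) (Y x)) ∧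
      (x ∉ D → 0 ≤ energyGap (withInclusion D K K' x) (K x) (X x) (Y x)) := by
  filter_upwards [hK, hK', hb, h₁.smul_le_sub, h₂.sub_le_smul] with x sK sK' bK k₁ k₂
  have hK0 : ∀ A, 0 ≤ ⟪K x A, A⟫_ℝ := fun A =>
    (by positivity : 0 ≤ s * c₀ * ‖A‖ ^ 2).trans (bK A).1
  refine ⟨fun hx => ?_, fun hx => ?_⟩
  · simp only [withInclusion, if_pos hx]
    have hgap := energyGap_ge_sub (L := K x) sK'
      (fun A => by linarith [k₁ A, mul_nonneg hη.le (hK0 A), hK0 A]) (X x) (Y x)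
    have hbound : (δ - 1) * ⟪K x (X x), X x⟫_ℝ ≤ (d - 1) * (s * c * ‖X x‖ ^ 2) := by
      refine mul_le_mul (by linarith) ((bK _).2.trans (by gcongr)) (hK0 _) (by linarith)
    linarith [k₂ (X x)]
  · simp only [withInclusion, if_neg hx]
    simpa using energyGap_ge_sub (L := K x) sK hK0 (X x) (Y x)

/-- Lower bound on the reversed gap for a soft inclusion; `K'` is nonnegative because `δ K ≤ K'`
with `δ > 0`. -/
theorem le_energyGap_withInclusion_of_softer (D : Set Plane) (hK : IsSymmField Ω K)
    (hK' : IsSymmField Ω K') (hb : FieldBounds Ω K (s * c₀) (s * c₁)) (hs : 0 < s)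
    (hc : 0 < c) (hc₀ : c ≤ c₀) (he : 0 < e) (heη : e ≤ η) (hδ : 0 < δ)
    (h₁ : FieldLE Ω (η • K) (K - K')) (h₂ : FieldLE Ω (K - K') ((1 - δ) • K))
    (X Y : Plane → SymTensor n) :
    ∀ᵐ x ∂(volume.restrict Ω),
      (x ∈ D → e * c * s * ‖X x‖ ^ 2 ≤
        energyGap (withInclusion D K K' x) (K x) (X x) (Y x)) ∧
      (x ∉ D → 0 ≤ energyGap (withInclusion D K K' x) (K x) (X x) (Y x)) := by
  filter_upwards [hK, hK', hb, h₁.smul_le_sub, h₂.sub_le_smul] with x sK sK' bK k₁ k₂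
  have hc₀' : 0 < c₀ := hc.trans_le hc₀
  have hK0 : ∀ A, 0 ≤ ⟪K x A, A⟫_ℝ := fun A =>
    (by positivity : 0 ≤ s * c₀ * ‖A‖ ^ 2).trans (bK A).1
  refine ⟨fun hx => ?_, fun hx => ?_⟩
  · simp only [withInclusion, if_pos hx]
    have hgap := energyGap_ge_sub (L := K x) sK'
      (fun A => by linarith [k₂ A, mul_nonneg hδ.le (hK0 A)]) (X x) (Y x)
    have hbound : e * (s * c * ‖X x‖ ^ 2) ≤ η * ⟪K x (X x), X x⟫_ℝ :=
      mul_le_mul heη (le_trans (by gcongr) (bK _).1) (by positivity) (he.le.trans heη)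
    linarith [k₁ (X x)]
  · simp only [withInclusion, if_neg hx]
    simpa using energyGap_ge_sub (L := K x) sK hK0 (X x) (Y x)

/-- Upper bound on the negative of the gap, for a soft inclusion. -/
theorem neg_le_energyGap_withInclusion_of_softer (D : Set Plane) (hK : IsSymmField Ω K)
    (hb : FieldBounds Ω K (s * c₀) (s * c₁)) (hs : 0 < s) (hc₀ : 0 < c₀) (hc : c₁ ≤ c)
    (hδ : δ < 1) (hd : 0 < d) (hdδ : d ≤ δ)
    (h₂ : FieldLE Ω (K - K') ((1 - δ) • K)) (X Y : Plane → SymTensor n) :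
    ∀ᵐ x ∂(volume.restrict Ω),
      (x ∈ D → -((1 - d) * c * s / d) * ‖Y x‖ ^ 2 ≤
        energyGap (K x) (withInclusion D K K' x) (X x) (Y x)) ∧
      (x ∉ D → 0 ≤ energyGap (K x) (withInclusion D K K' x) (X x) (Y x)) := by
  filter_upwards [hK, hb, h₂.sub_le_smul] with x sK bK k₂
  have hK0 : ∀ A, 0 ≤ ⟪K x A, A⟫_ℝ := fun A =>
    (by positivity : 0 ≤ s * c₀ * ‖A‖ ^ 2).trans (bK A).1
  refine ⟨fun hx => ?_, fun hx => ?_⟩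
  · simp only [withInclusion, if_pos hx]
    have hgap := energyGap_ge_of_smul_le (L := K' x) sK hK0 hd
      (fun A => by linarith [k₂ A, mul_le_mul_of_nonneg_right hdδ (hK0 A)]) (X x) (Y x)
    have hbound : (1 / d - 1) * ⟪K x (Y x), Y x⟫_ℝ ≤ (1 / d - 1) * (s * c * ‖Y x‖ ^ 2) :=
      mul_le_mul_of_nonneg_left ((bK _).2.trans (by gcongr))
        (sub_nonneg.2 (one_le_one_div hd (by linarith)))
    have e1 : -((1 - d) * c * s / d) * ‖Y x‖ ^ 2 = -((1 / d - 1) * (s * c * ‖Y x‖ ^ 2)) := by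
      field_simp
    linarith
  · simp only [withInclusion, if_neg hx]
    simpa using energyGap_ge_sub (L := K x) sK hK0 (X x) (Y x)

end Inclusion

theorem lemma4p1
    (Ω : Set Plane) (hΩ_open : IsOpen Ω) (hΩ_conn : IsConnected Ω)
    (hΩ_bdd : Bornology.IsBounded Ω) (hΩ_class : BoundaryClass Ω 2 1)
    (D : Set Plane) (hD_sub : D ⊆ Ω) (hD_meas : NullMeasurableSet D volume)
    (t : ℝ) (ht : 0 < t)
    (P Ph P' Ph' : TensorField 2) (Q Q' : TensorField 3)
    (hP : IsBoundedField Ω P) (hPh : IsBoundedField Ω Ph)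
    (hP' : IsBoundedField Ω P') (hPh' : IsBoundedField Ω Ph')
    (hQ : IsBoundedField Ω Q) (hQ' : IsBoundedField Ω Q')
    (hP_symm : IsSymmField Ω P) (hPh_symm : IsSymmField Ω Ph)
    (hP'_symm : IsSymmField Ω P') (hPh'_symm : IsSymmField Ω Ph')
    (hQ_symm : IsSymmField Ω Q) (hQ'_symm : IsSymmField Ω Q')
    (ξ₀ ξ₁ ξb₀ ξb₁ : ℝ) (hξ₀ : 0 < ξ₀) (hξ₁ : ξ₀ < ξ₁) (hξb₀ : 0 < ξb₀) (hξb₁ : ξb₀ < ξb₁)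
    (hP_bounds : FieldBounds Ω (P + Ph) (t ^ 3 * ξ₀) (t ^ 3 * ξ₁))
    (hQ_bounds : FieldBounds Ω Q (t ^ 5 * ξb₀) (t ^ 5 * ξb₁))
    (F : NeumannData Ω) (hF : F.Compatible)
    (u u₀ : Plane → ℝ)
    (hu : IsWeakSolution Ω (withInclusion D (P + Ph) (P' + Ph')) (withInclusion D Q Q') F u)
    (hu_norm : Normalized Ω u)
    (hu₀ : IsWeakSolution Ω (P + Ph) Q F u₀) (hu₀_norm : Normalized Ω u₀)
    (η ηb δ δb : ℝ) (hη : 0 < η) (hηb : 0 < ηb) :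
    ((1 < δ ∧ 1 < δb ∧
        FieldLE Ω (η • (P + Ph)) ((P' + Ph') - (P + Ph)) ∧
        FieldLE Ω ((P' + Ph') - (P + Ph)) ((δ - 1) • (P + Ph)) ∧
        FieldLE Ω (ηb • Q) (Q' - Q) ∧ FieldLE Ω (Q' - Q) ((δb - 1) • Q)) →
      min η ηb * min ξ₀ ξb₀ * t ^ 3 / max δ δb *
          ∫ x in D, (‖weakD Ω 2 u₀ x‖ ^ 2 + t ^ 2 * ‖weakD Ω 3 u₀ x‖ ^ 2)
        ≤ F.work u₀ - F.work u ∧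
      F.work u₀ - F.work u
        ≤ (max δ δb - 1) * max ξ₁ ξb₁ * t ^ 3 *
          ∫ x in D, (‖weakD Ω 2 u₀ x‖ ^ 2 + t ^ 2 * ‖weakD Ω 3 u₀ x‖ ^ 2)) ∧
    ((0 < δ ∧ δ < 1 ∧ 0 < δb ∧ δb < 1 ∧
        FieldLE Ω (η • (P + Ph)) ((P + Ph) - (P' + Ph')) ∧
        FieldLE Ω ((P + Ph) - (P' + Ph')) ((1 - δ) • (P + Ph)) ∧
        FieldLE Ω (ηb • Q) (Q - Q') ∧ FieldLE Ω (Q - Q') ((1 - δb) • Q)) →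
      min η ηb * min ξ₀ ξb₀ * t ^ 3 *
          ∫ x in D, (‖weakD Ω 2 u₀ x‖ ^ 2 + t ^ 2 * ‖weakD Ω 3 u₀ x‖ ^ 2)
        ≤ F.work u - F.work u₀ ∧
      F.work u - F.work u₀
        ≤ (1 - min δ δb) * max ξ₁ ξb₁ * t ^ 3 / min δ δb *
          ∫ x in D, (‖weakD Ω 2 u₀ x‖ ^ 2 + t ^ 2 * ‖weakD Ω 3 u₀ x‖ ^ 2)) := by
  have hA := hP.add hPh
  have hA1 := hA.withInclusion (hP'.add hPh') hD_meas
  have hQ1 := hQ.withInclusion hQ' hD_meas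
  have hA_symm := hP_symm.add hPh_symm
  have hA'_symm := hP'_symm.add hPh'_symm
  have ht3 : 0 < t ^ 3 := by positivity
  have ht5 : 0 < t ^ 5 := by positivity
  have hξ : 0 < min ξ₀ ξb₀ := lt_min hξ₀ hξb₀
  have : 0 < max ξ₁ ξb₁ := lt_max_of_lt_left (hξ₀.trans hξ₁)
  have hη' : 0 < min η ηb := lt_min hη hηb
  constructor
  · rintro ⟨hδ, hδb, h1, h2, h3, h4⟩
    constructor
    · exact const_mul_setIntegral_le_work_sub hA hA1 hQ hQ1 hu₀ hu hu₀.1 hD_sub hD_meas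
        (by ring)
        (le_energyGap_withInclusion_of_stiffer D hA_symm hP_bounds ht3 hξ (min_le_left _ _) hη'
          (min_le_left _ _) (le_max_left _ _) h1 h2 _ _)
        (le_energyGap_withInclusion_of_stiffer D hQ_symm hQ_bounds ht5 hξ (min_le_right _ _) hη'
          (min_le_right _ _) (le_max_right _ _) h3 h4 _ _)
    · have h := const_mul_setIntegral_le_work_sub hA1 hA hQ1 hQ hu hu₀ hu₀.1 hD_sub hD_meas
        (t := t) (by ring)
        (neg_le_energyGap_withInclusion_of_stiffer D hA_symm hA'_symm hP_bounds ht3 hξ₀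
          (le_max_left ξ₁ ξb₁) hη hδ (le_max_left δ δb) h1 h2 _ _)
        (neg_le_energyGap_withInclusion_of_stiffer D hQ_symm hQ'_symm hQ_bounds ht5 hξb₀
          (le_max_right ξ₁ ξb₁) hηb hδb (le_max_right δ δb) h3 h4 _ _)
      linarith
  · rintro ⟨hδ, hδ1, hδb, hδb1, h1, h2, h3, h4⟩
    constructor
    · exact const_mul_setIntegral_le_work_sub hA1 hA hQ1 hQ hu hu₀ hu₀.1 hD_sub hD_meas
        (by ring)
        (le_energyGap_withInclusion_of_softer D hA_symm hA'_symm hP_bounds ht3 hξ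
          (min_le_left _ _) hη' (min_le_left _ _) hδ h1 h2 _ _)
        (le_energyGap_withInclusion_of_softer D hQ_symm hQ'_symm hQ_bounds ht5 hξ
          (min_le_right _ _) hη' (min_le_right _ _) hδb h3 h4 _ _)
    · have h := const_mul_setIntegral_le_work_sub hA hA1 hQ hQ1 hu₀ hu hu₀.1 hD_sub hD_meas
        (t := t) (by ring)
        (neg_le_energyGap_withInclusion_of_softer D hA_symm hP_bounds ht3 hξ₀
          (le_max_left ξ₁ ξb₁) hδ1 (lt_min hδ hδb) (min_le_left δ δb) h2 _ _)
        (neg_le_energyGap_withInclusion_of_softer D hQ_symm hQ_bounds ht5 hξb₀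
          (le_max_right ξ₁ ξb₁) hδb1 (lt_min hδ hδb) (min_le_right δ δb) h4 _ _)
      linarith
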